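/- A virtual knot is a class of knot diagrams with classical and virtual crossings modulo the classical and virtual Reidemeister moves; equivalently, a class of Gauss diagrams modulo the Gauss diagram forms of the classical Reidemeister moves. It is \emph{classical} if it has a diagram without virtual crossings, and \emph{non-classical} otherwise. A \emph{virtual pseudodiagram} $P$ is a diagram of a virtual knot in which some of the non-virtual crossings, the \emph{precrossings}, are undetermined; a precrossing is resolved by making it a positive or a negative classical crossing. Let $C_p$ be the set of precrossings of $P$, and let $\mathrm{Odd}(P)$ be the set of those classical crossings and precrossings of $P$ whose chord intersects an odd number of chords in the chord diagram of $P$ (the diagram of all classical crossings and precrossings). The \emph{virtualizing number} $\mathrm{vir}(P)$ (respectively the \emph{classicalizing number} $\mathrm{cl}(P)$) is the minimum number of precrossings that have to be resolved, with suitably chosen signs, so that the knot is non-classical (respectively classical) however the remaining precrossings are resolved; it is $\infty$ if this cannot be achieved. \textbf{Theorem.} Let $P$ be a virtual pseudodiagram. Then $|\mathrm{Odd}(P)|$ is even, and the following hold. 1. If $\mathrm{Odd}(P)$ contains a precrossing, then $\mathrm{vir}(P) \le \frac{|\mathrm{Odd}(P)|}{2}+1$. 2. If $S \subseteq \mathrm{Odd}(P)\cap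 C_p$ is a set of $\frac{|\mathrm{Odd}(P)|}{2}+1$ odd precrossings, then after resolving the precrossings in $S$ positively, every resolution of the remaining precrossings gives a non-classical knot. 3. $\mathrm{cl}(P) \ge |\mathrm{Odd}(P)\cap C_p|$. -/

import Mathlib

/-! ## Gauss diagrams and virtual knots -/

/-- An endpoint of a chord of a Gauss diagram: the label of the chord (that is, of the classical
crossing), whether this passage through the crossing is the over-passage (tail of the arrow) or
the under-passage (head of the arrow), and the local writhe of the crossing. -/
structure GaussEnd where
  label : ℕ
  isOver : Bool
  sign : ℤˣ

/-- A Gauss diagram, written as the word of chord endpoints met when the core circle is traversed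
once from a base point.  Every chord occurs exactly twice, once as over-passage and once as
under-passage, with the same sign. Words that differ by the choice of the base point or of the
labels are identified by `GaussDiagram.Equivalent` below. -/
structure GaussDiagram where
  word : List GaussEnd
  nodup : word.Nodup
  partner_mem : ∀ x ∈ word, (⟨x.label, !x.isOver, x.sign⟩ : GaussEnd) ∈ word
  sign_eq : ∀ x ∈ word, ∀ y ∈ word, x.label = y.label → x.sign = y.sign

/-- Two consecutive endpoints on an arc of the core circle: `x` then `y` if `o = 1`, and `y` then
`x` if `o = -1`. -/
def gaussArc (o : ℤˣ) (x y : GaussEnd) : List GaussEnd :=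
  if o = 1 then [x, y] else [y, x]

/-- The moves on words of Gauss diagrams: change of base point, renaming of chords, and the
(classical, oriented) Reidemeister moves. Virtual Reidemeister moves do not change the Gauss
diagram. -/
inductive GaussMove : List GaussEnd → List GaussEnd → Prop
  /-- change of the base point -/
  | rotate (u v : List GaussEnd) : GaussMove (u ++ v) (v ++ u)
  /-- renaming of the chords -/
  | relabel (f : Equiv.Perm ℕ) (w : List GaussEnd) :
      GaussMove w (w.map fun x => ⟨f x.label, x.isOver, x.sign⟩)
  /-- first Reidemeister move: delete a chord with adjacent endpoints -/
  | r1 (c : ℕ) (b : Bool) (s : ℤˣ) (w : List GaussEnd) :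
      GaussMove ([⟨c, b, s⟩, ⟨c, !b, s⟩] ++ w) w
  /-- second Reidemeister move: delete two chords of opposite signs whose tails are adjacent and
  whose heads are adjacent (strands running in the same direction for `o = 1`, in opposite
  directions for `o = -1`) -/
  | r2 (c d : ℕ) (s o : ℤˣ) (u v : List GaussEnd) :
      GaussMove
        ([⟨c, true, s⟩, ⟨d, true, -s⟩] ++ u ++ gaussArc o ⟨c, false, s⟩ ⟨d, false, -s⟩ ++ v)
        (u ++ v)
  /-- third Reidemeister move, with the top, middle and bottom strands met in this cyclic order.
  The chord `x` (sign `a`) joins the top to the middle strand, `y` (sign `b`) the top to the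
  bottom strand, `z` (sign `c`) the middle to the bottom strand; `p`, `q`, `r` record the order of
  the two crossings on the top, middle and bottom strand. The two equations say that
  the three strands bound a triangle. -/
  | r3 (x y z : ℕ) (a b c p q r : ℤˣ) (hpq : p * q = b * c) (hqr : q * r = a * b)
      (u v w : List GaussEnd) :
      GaussMove
        (gaussArc p ⟨x, true, a⟩ ⟨y, true, b⟩ ++ u ++
          gaussArc q ⟨x, false, a⟩ ⟨z, true, c⟩ ++ v ++
          gaussArc r ⟨y, false, b⟩ ⟨z, false, c⟩ ++ w)
        (gaussArc (-p) ⟨x, true, a⟩ ⟨y, true, b⟩ ++ u ++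
          gaussArc (-q) ⟨x, false, a⟩ ⟨z, true, c⟩ ++ v ++
          gaussArc (-r) ⟨y, false, b⟩ ⟨z, false, c⟩ ++ w)
  /-- third Reidemeister move, with the top, bottom and middle strands met in this cyclic order -/
  | r3' (x y z : ℕ) (a b c p q r : ℤˣ) (hpq : p * q = b * c) (hqr : q * r = a * b)
      (u v w : List GaussEnd) :
      GaussMove
        (gaussArc p ⟨x, true, a⟩ ⟨y, true, b⟩ ++ u ++
          gaussArc r ⟨y, false, b⟩ ⟨z, false, c⟩ ++ v ++
          gaussArc q ⟨x, false, a⟩ ⟨z, true, c⟩ ++ w)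
        (gaussArc (-p) ⟨x, true, a⟩ ⟨y, true, b⟩ ++ u ++
          gaussArc (-r) ⟨y, false, b⟩ ⟨z, false, c⟩ ++ v ++
          gaussArc (-q) ⟨x, false, a⟩ ⟨z, true, c⟩ ++ w)

namespace GaussDiagram

/-- Two Gauss diagrams represent the same virtual knot if they are related by a finite sequence
of moves and inverse moves (through Gauss diagrams). -/
def Equivalent : GaussDiagram → GaussDiagram → Prop :=
  Relation.EqvGen fun D E => GaussMove D.word E.word

/-- The directed arcs of the core circle: `(i, true)` runs from the `i`-th endpoint to the
cyclically next one, and `(i, false)` is the same arc run backwards. -/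
abbrev Dart (D : GaussDiagram) : Type := Fin D.word.length × Bool

/-- The position of the endpoint from which a directed arc starts. -/
def dartSource (D : GaussDiagram) (e : D.Dart) : Fin D.word.length :=
  if e.2 then e.1 else finRotate _ e.1

/-- The position of the endpoint at which a directed arc arrives. -/
def dartTarget (D : GaussDiagram) (e : D.Dart) : Fin D.word.length :=
  if e.2 then finRotate _ e.1 else e.1

/-- At a crossing, let `α` be the over-strand if the crossing is positive and the under-strand if
it is negative, and let `β` be the other strand. In the oriented surface carrying the diagram,
`β` then crosses `α` from right to left. `IsAlpha D i` says that the `i`-th passage through a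
crossing is along the strand `α`. -/
def IsAlpha (D : GaussDiagram) (i : Fin D.word.length) : Prop :=
  (D.word.get i).isOver = true ↔ (D.word.get i).sign = 1

/-- `FaceStep e f`: a traveller who arrives at a crossing along the directed arc `e` and turns left
continues along the directed arc `f`. She leaves the crossing on its other strand; she follows the
orientation of the knot after the turn exactly if she did so before the turn and came along `α`,
or did not and came along `β`. -/
def FaceStep (D : GaussDiagram) (e f : D.Dart) : Prop :=
  D.dartSource f ≠ D.dartTarget e ∧
  (D.word.get (D.dartSource f)).label = (D.word.get (D.dartTarget e)).label ∧
  (f.2 = e.2 ↔ D.IsAlpha (D.dartTarget e))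

/-- The number of faces of the knot projection on its carrier surface, that is, of boundary circles
of the ribbon graph of the Gauss diagram: the number of orbits of `FaceStep`. -/
noncomputable def numFaces (D : GaussDiagram) : ℕ := Nat.card (Quot D.FaceStep)

/-- The Gauss diagram is that of a knot diagram in the sphere (or plane) without virtual crossings:
its carrier surface, with `n` vertices, `2 n` edges and `F` faces, has Euler characteristic
`n - 2 n + F = 2`. Here the length of the word is `2 n`. The diagram without crossings, whose
projection is a circle without vertices, is listed separately. -/
def IsPlanar (D : GaussDiagram) : Prop :=
  D.word = [] ∨ 2 * D.numFaces = D.word.length + 4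

/-- The virtual knot represented by `D` is a classical knot: it has a diagram without virtual
crossings. -/
def IsClassical (D : GaussDiagram) : Prop :=
  ∃ E : GaussDiagram, D.Equivalent E ∧ E.IsPlanar

end GaussDiagram

/-! ## Virtual pseudodiagrams -/

/-- A virtual pseudodiagram with `n` crossings other than the virtual ones, recorded by its Gauss
diagram. The word lists the passages through crossings in the order in which they are met: `(c, true)`
is the passage of the crossing `c` along the strand `α` and `(c, false)` the passage along the
strand `β`, where `β` crosses `α` from right to left (this makes sense at a flat crossing).
`info c` is the local writhe of `c`, or `none` if `c` is a precrossing.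
If `c` is, or is resolved to be, positive then `α` passes over `β`, and if it is negative
then `β` passes over `α`. -/
structure VirtualPseudodiagram where
  n : ℕ
  word : List (Fin n × Bool)
  nodup : word.Nodup
  mem_word : ∀ x, x ∈ word
  info : Fin n → Option ℤˣ

namespace VirtualPseudodiagram

/-- The same virtual shadow with other crossing information. -/
def withInfo (P : VirtualPseudodiagram) (τ : Fin P.n → Option ℤˣ) : VirtualPseudodiagram where
  n := P.n
  word := P.word
  nodup := P.nodup
  mem_word := P.mem_word
  info := τ

/-- The set of precrossings. -/
def precrossings (P : VirtualPseudodiagram) : Finset (Fin P.n) :=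
  Finset.univ.filter fun c => P.info c = none

/-- `τ` arises from the crossing information of `P` by resolving some of the precrossings. -/
def IsPartialResolution (P : VirtualPseudodiagram) (τ : Fin P.n → Option ℤˣ) : Prop :=
  ∀ c s, P.info c = some s → τ c = some s

/-- The number of precrossings of `P` that are resolved in `τ`. -/
def numResolved (P : VirtualPseudodiagram) (τ : Fin P.n → Option ℤˣ) : ℕ :=
  (P.precrossings.filter fun c => τ c ≠ none).card

/-- `σ` arises from the crossing information of `P` by resolving all the precrossings. -/
def IsResolution (P : VirtualPseudodiagram) (σ : Fin P.n → ℤˣ) : Prop :=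
  ∀ c s, P.info c = some s → σ c = s

/-- The endpoint in the Gauss diagram of a passage through a crossing of sign `σ c`. -/
def toGaussEnd {n : ℕ} (σ : Fin n → ℤˣ) (x : Fin n × Bool) : GaussEnd :=
  ⟨x.1, if σ x.1 = 1 then x.2 else !x.2, σ x.1⟩

theorem toGaussEnd_injective {n : ℕ} (σ : Fin n → ℤˣ) :
    Function.Injective (toGaussEnd σ) := by
  rintro ⟨c, b⟩ ⟨d, e⟩ h
  simp only [toGaussEnd, GaussEnd.mk.injEq] at h
  obtain ⟨h1, h2, -⟩ := h
  obtain rfl := Fin.ext h1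
  split_ifs at h2 <;> simp_all

/-- The Gauss diagram obtained from the virtual shadow of `P` by giving every crossing `c` the local
writhe `σ c`. -/
def diagram (P : VirtualPseudodiagram) (σ : Fin P.n → ℤˣ) : GaussDiagram where
  word := P.word.map (toGaussEnd σ)
  nodup := P.nodup.map (toGaussEnd_injective σ)
  partner_mem := by
    intro x hx
    obtain ⟨y, -, rfl⟩ := List.mem_map.1 hx
    refine List.mem_map.2 ⟨(y.1, !y.2), P.mem_word _, ?_⟩
    simp only [toGaussEnd]
    split_ifs <;> rfl
  sign_eq := by
    intro x hx y hy h
    obtain ⟨x, -, rfl⟩ := List.mem_map.1 hx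
    obtain ⟨y, -, rfl⟩ := List.mem_map.1 hy
    simp only [toGaussEnd] at h ⊢
    rw [Fin.ext h]

/-- However the precrossings are resolved, the resulting knot is non-classical. -/
def NecessarilyNonclassical (P : VirtualPseudodiagram) : Prop :=
  ∀ σ, P.IsResolution σ → ¬ (P.diagram σ).IsClassical

/-- However the precrossings are resolved, the resulting knot is classical. -/
def NecessarilyClassical (P : VirtualPseudodiagram) : Prop :=
  ∀ σ, P.IsResolution σ → (P.diagram σ).IsClassical

/-- The virtualizing number `vir(P)`: the minimum number of precrossings that must be resolved to
make `P` necessarily non-classical, and `⊤` if this is impossible. -/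
noncomputable def virtualizingNumber (P : VirtualPseudodiagram) : ℕ∞ :=
  ⨅ (τ : Fin P.n → Option ℤˣ) (_ : P.IsPartialResolution τ)
    (_ : (P.withInfo τ).NecessarilyNonclassical), (P.numResolved τ : ℕ∞)

/-- The classicalizing number `cl(P)`: the minimum number of precrossings that must be resolved to
make `P` necessarily classical, and `⊤` if this is impossible. -/
noncomputable def classicalizingNumber (P : VirtualPseudodiagram) : ℕ∞ :=
  ⨅ (τ : Fin P.n → Option ℤˣ) (_ : P.IsPartialResolution τ)
    (_ : (P.withInfo τ).NecessarilyClassical), (P.numResolved τ : ℕ∞)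

/-- Resolve the precrossings in `S` positively. -/
def resolvePositively (P : VirtualPseudodiagram) (S : Finset (Fin P.n)) : VirtualPseudodiagram :=
  P.withInfo fun c => if c ∈ S then some 1 else P.info c

/-- The position in the word of a passage through the crossing `c`. -/
def pos (P : VirtualPseudodiagram) (c : Fin P.n) (b : Bool) : ℕ := P.word.idxOf (c, b)

/-- The passage `(d, b)` lies strictly between the two passages through `c`. -/
def OnArc (P : VirtualPseudodiagram) (c d : Fin P.n) (b : Bool) : Prop :=
  min (P.pos c true) (P.pos c false) < P.pos d b ∧ P.pos d b < max (P.pos c true) (P.pos c false)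

/-- The chords `c` and `d` intersect in the chord diagram: exactly one endpoint of `d` lies between
the endpoints of `c`. -/
def Intersect (P : VirtualPseudodiagram) (c d : Fin P.n) : Prop :=
  Xor (P.OnArc c d true) (P.OnArc c d false)

open Classical in
/-- `Odd(P)`: the classical crossings and precrossings whose chord intersects an odd number of chords
of the chord diagram of `P`. -/
noncomputable def oddCrossings (P : VirtualPseudodiagram) : Finset (Fin P.n) :=
  Finset.univ.filter fun c => Odd (Finset.univ.filter fun d => P.Intersect c d).card

end VirtualPseudodiagram

/-! Everything follows from the odd writhe, the sum of the signs of the odd crossings. It is an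
invariant of virtual knots and vanishes on classical knots, so a resolution with non-zero odd writhe
is non-classical.

The parity of a chord is read off the word: the number of endpoints strictly between its two ends
has the parity of the number of chords it intersects, so the chord is odd exactly when its ends lie
at positions of equal parity. The squared alternating count is then 4 for odd chords and 0 for even
ones. Squaring makes it insensitive to a shift of the base point and to the unit shifts in the third
Reidemeister move. Invariance is checked move by move
(`GaussDiagram.Equivalent.scaledOddWrithe_eq`).

Vanishing is Gauss's parity condition, that planar diagrams have no odd chords
(`GaussDiagram.odd_sub_of_planar`). A chord cuts the core circle into two loops. On the sphere each
is a mod 2 boundary, so it separates two classes of faces. Following the colour of the left-hand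
face once around the knot shows that the loop has an odd number of arcs. That the loop bounds is a
dimension count over `ZMod 2` from the Euler characteristic.

The bounds are then arithmetic of a sum of signs. If more than half of the odd crossings are
positive, the sum is positive. Flipping one odd crossing changes the sum by 2, so with all odd
precrossings resolved some choice of signs makes it non-zero, while an unresolved odd precrossing
prevents it from always being zero. Evenness of `|Odd(P)|` is the handshake lemma for the
intersection graph. -/

/-! ## The odd writhe -/

/-- The alternating count of the endpoints of the chord `c`: the sum of `(-1) ^ k` over the
positions `k` of its endpoints. -/
def altCount (c : ℕ) : List GaussEnd → ℤ
  | [] => 0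
  | x :: w => (if x.label = c then 1 else 0) - altCount c w

/-- Eight times the odd writhe: in the word of a Gauss diagram the alternating count of a chord is
`± 2` if the chord intersects an odd number of chords and `0` otherwise. -/
def scaledOddWrithe (w : List GaussEnd) : ℤ :=
  (w.map fun x => (x.sign : ℤ) * altCount x.label w ^ 2).sum

theorem altCount_append (c : ℕ) (u v : List GaussEnd) :
    altCount c (u ++ v) = altCount c u + (-1) ^ u.length * altCount c v := by
  induction u with
  | nil => simp [altCount]
  | cons x u ih => simp only [List.cons_append, altCount, ih, List.length_cons, pow_succ]; ring

theorem altCount_eq_zero {c : ℕ} {w : List GaussEnd} (h : ∀ x ∈ w, x.label ≠ c) :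
    altCount c w = 0 := by
  induction w with
  | nil => rfl
  | cons x w ih =>
    simp only [altCount, h x (by simp), ih fun y hy => h y (by simp [hy]), if_false, sub_zero]

theorem altCount_eq_sum (c : ℕ) (w : List GaussEnd) :
    altCount c w = ∑ k : Fin w.length, if (w.get k).label = c then (-1) ^ (k : ℕ) else 0 := by
  induction w with
  | nil => simp [altCount]
  | cons x w ih =>
    simp only [altCount, ih, List.length_cons]
    rw [Fin.sum_univ_succ, sub_eq_add_neg, ← Finset.sum_neg_distrib]
    congr 1
    refine Finset.sum_congr rfl fun k _ => ?_
    simp only [List.get_eq_getElem, Fin.val_succ, List.getElem_cons_succ, pow_succ]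
    split_ifs <;> simp

theorem altCount_map_relabel (f : Equiv.Perm ℕ) (c : ℕ) (w : List GaussEnd) :
    altCount (f c) (w.map fun x => ⟨f x.label, x.isOver, x.sign⟩) = altCount c w := by
  induction w with
  | nil => rfl
  | cons x w ih => simp [altCount, ih]

theorem length_gaussArc (o : ℤˣ) (x y : GaussEnd) : (gaussArc o x y).length = 2 := by
  unfold gaussArc; split_ifs <;> rfl

theorem mem_gaussArc {o : ℤˣ} {x y z : GaussEnd} : z ∈ gaussArc o x y ↔ z = x ∨ z = y := by
  unfold gaussArc; split_ifs <;> simp [or_comm]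

theorem sum_map_gaussArc (f : GaussEnd → ℤ) (o : ℤˣ) (x y : GaussEnd) :
    ((gaussArc o x y).map f).sum = f x + f y := by
  unfold gaussArc; split_ifs <;> simp [add_comm]

theorem altCount_gaussArc (c : ℕ) (o : ℤˣ) (x y : GaussEnd) :
    altCount c (gaussArc o x y) =
      o * ((if x.label = c then 1 else 0) - (if y.label = c then 1 else 0)) := by
  rcases Int.units_eq_one_or o with rfl | rfl
  · simp [gaussArc, altCount]
  · rw [gaussArc, if_neg (by decide)]
    simp [altCount]

namespace GaussDiagram

theorem eq_or_eq_of_label_eq (D : GaussDiagram) {x y : GaussEnd} (hx : x ∈ D.word)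
    (hy : y ∈ D.word) (h : y.label = x.label) : y = x ∨ y = ⟨x.label, !x.isOver, x.sign⟩ := by
  have hs := D.sign_eq y hy x hx h
  obtain ⟨l, b, s⟩ := x
  obtain ⟨l', b', s'⟩ := y
  simp only at h hs
  subst h hs
  cases b <;> cases b' <;> simp

theorem even_length (D : GaussDiagram) : Even D.word.length := by
  classical
  rw [← List.toFinset_card_of_nodup D.nodup, ← ZMod.natCast_eq_zero_iff_even,
    Finset.cast_card]
  refine Finset.sum_involution (fun x _ => ⟨x.label, !x.isOver, x.sign⟩) ?_ ?_ ?_ ?_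
  · intros; decide
  · rintro ⟨l, b, s⟩ - - h
    simp at h
  · intro x hx
    simpa using D.partner_mem x (by simpa using hx)
  · simp

/-- A block closed under passing to the other endpoint contains both ends of each of its chords, so
no third endpoint with such a label is left. This isolates the chords taking part in a Reidemeister
move. -/
theorem label_ne_of_perm (D : GaussDiagram) {A B : List GaussEnd} (h : D.word.Perm (A ++ B))
    (hA : ∀ x ∈ A, (⟨x.label, !x.isOver, x.sign⟩ : GaussEnd) ∈ A) :
    ∀ x ∈ A, ∀ y ∈ B, y.label ≠ x.label := by
  intro x hx y hy hl
  have hd := (List.nodup_append'.1 (h.nodup_iff.1 D.nodup)).2.2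
  rcases D.eq_or_eq_of_label_eq (x := x) (y := y) (h.mem_iff.2 (by simp [hx]))
    (h.mem_iff.2 (by simp [hy])) hl with rfl | rfl
  · exact hd hx hy
  · exact hd (hA x hx) hy

end GaussDiagram

/-! ### Invariance of the odd writhe under the moves -/

theorem scaledOddWrithe_rotate (D : GaussDiagram) {u v : List GaussEnd} (hD : D.word = u ++ v) :
    scaledOddWrithe (u ++ v) = scaledOddWrithe (v ++ u) := by
  have hev := D.even_length
  rw [hD, List.length_append] at hev
  have key (c : ℕ) : altCount c (u ++ v) ^ 2 = altCount c (v ++ u) ^ 2 := by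
    -- The word has even length, so both pieces have the same parity and the two counts agree up to
    -- a global sign.
    have hp : ((-1 : ℤ)) ^ u.length = (-1) ^ v.length := by
      rcases Nat.even_or_odd u.length with h | h
      · rw [h.neg_one_pow, ((Nat.even_add.1 hev).1 h).neg_one_pow]
      · have : Odd v.length := by
          rw [← Nat.not_even_iff_odd] at h ⊢
          exact fun h' => h ((Nat.even_add.1 hev).2 h')
        rw [h.neg_one_pow, this.neg_one_pow]
    rw [altCount_append, altCount_append, hp]
    rcases neg_one_pow_eq_or ℤ v.length with h | h <;> rw [h] <;> ring
  simp only [scaledOddWrithe, key]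
  simp only [List.map_append, List.sum_append, add_comm]

theorem scaledOddWrithe_relabel (f : Equiv.Perm ℕ) (w : List GaussEnd) :
    scaledOddWrithe w = scaledOddWrithe (w.map fun x => ⟨f x.label, x.isOver, x.sign⟩) := by
  simp only [scaledOddWrithe, List.map_map, Function.comp_def, altCount_map_relabel]

/-- Adjacent endpoints of one chord cancel in its alternating count, so the deleted chord is even;
all other positions move by two. -/
theorem scaledOddWrithe_r1 (D : GaussDiagram) {c : ℕ} {b : Bool} {s : ℤˣ} {w : List GaussEnd}
    (hD : D.word = [⟨c, b, s⟩, ⟨c, !b, s⟩] ++ w) :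
    scaledOddWrithe ([⟨c, b, s⟩, ⟨c, !b, s⟩] ++ w) = scaledOddWrithe w := by
  have hne := D.label_ne_of_perm (A := [⟨c, b, s⟩, ⟨c, !b, s⟩]) (B := w) (hD ▸ List.Perm.refl _)
    (by simp) ⟨c, b, s⟩ (by simp)
  simp only at hne
  have key (l : ℕ) : altCount l ([⟨c, b, s⟩, ⟨c, !b, s⟩] ++ w) = altCount l w := by
    simp [altCount]
  simp only [scaledOddWrithe, key, List.map_append, List.sum_append]
  simp [altCount_eq_zero hne]

theorem scaledOddWrithe_r2 (D : GaussDiagram) {c d : ℕ} {s o : ℤˣ} {u v : List GaussEnd}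
    (hD : D.word = [⟨c, true, s⟩, ⟨d, true, -s⟩] ++ u ++
      gaussArc o ⟨c, false, s⟩ ⟨d, false, -s⟩ ++ v) :
    scaledOddWrithe ([⟨c, true, s⟩, ⟨d, true, -s⟩] ++ u ++
      gaussArc o ⟨c, false, s⟩ ⟨d, false, -s⟩ ++ v) = scaledOddWrithe (u ++ v) := by
  have hne := D.label_ne_of_perm
    (A := [⟨c, true, s⟩, ⟨d, true, -s⟩] ++ gaussArc o ⟨c, false, s⟩ ⟨d, false, -s⟩) (B := u ++ v)
    (by
      rw [hD]
      simp only [List.append_assoc]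
      refine List.Perm.append_left _ ?_
      rw [← List.append_assoc, ← List.append_assoc]
      exact List.perm_append_comm.append_right _)
    (by simp [mem_gaussArc])
  have hc := hne ⟨c, true, s⟩ (by simp)
  have hd := hne ⟨d, true, -s⟩ (by simp)
  have hcd : c ≠ d := by
    intro h
    have := D.sign_eq ⟨c, true, s⟩ (by simp [hD]) ⟨d, true, -s⟩ (by simp [hD]) h
    exact units_ne_neg_self s this
  have hc' (w) (hw : w = u ∨ w = v) : altCount c w = 0 :=
    altCount_eq_zero fun x hx => hc x (by rcases hw with rfl | rfl <;> simp [hx])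
  have hd' (w) (hw : w = u ∨ w = v) : altCount d w = 0 :=
    altCount_eq_zero fun x hx => hd x (by rcases hw with rfl | rfl <;> simp [hx])
  set W := [⟨c, true, s⟩, ⟨d, true, -s⟩] ++ u ++
      gaussArc o ⟨c, false, s⟩ ⟨d, false, -s⟩ ++ v with hW
  have hfar (l : ℕ) (h1 : l ≠ c) (h2 : l ≠ d) : altCount l W = altCount l (u ++ v) := by
    simp only [hW, altCount_append, altCount_gaussArc, List.length_append, length_gaussArc,
      altCount, h1.symm, h2.symm, pow_add]
    simp
  -- Both tails and both heads are adjacent, so the counts of `c` and `d` are negatives of each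
  -- other. With opposite chord signs the two contributions cancel.
  have hsq : altCount c W ^ 2 = altCount d W ^ 2 := by
    simp only [hW, altCount_append, altCount_gaussArc, List.length_append, length_gaussArc,
      altCount, hcd, hcd.symm, hc', hd', true_or, or_true, if_true, if_false]
    ring
  have hsum : ((u ++ v).map fun x => (x.sign : ℤ) * altCount x.label W ^ 2) =
      (u ++ v).map fun x => (x.sign : ℤ) * altCount x.label (u ++ v) ^ 2 :=
    List.map_congr_left fun x hx => by rw [hfar _ (hc x hx) (hd x hx)]
  have hsum' := congrArg List.sum hsum
  rw [List.map_append, List.sum_append] at hsum'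
  rw [scaledOddWrithe, scaledOddWrithe, ← hsum']
  nth_rw 2 [hW]
  simp only [List.map_append, List.sum_append, sum_map_gaussArc, List.map_cons, List.map_nil,
    List.sum_cons, List.sum_nil, hsq, Units.val_neg]
  ring

/-- Swapping the endpoints on three arcs, where each of the chords involved has its endpoints on
two of the arcs, does not change the odd writhe. -/
theorem scaledOddWrithe_swap_arcs {p q r : ℤˣ} {x₁ x₂ x₃ x₄ x₅ x₆ : GaussEnd}
    {u v w : List GaussEnd}
    (h : ∀ l, (∀ x ∈ [x₁, x₂, x₃, x₄, x₅, x₆], x.label ≠ l) ∨ ∀ y ∈ u ++ v ++ w, y.label ≠ l) :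
    scaledOddWrithe (gaussArc p x₁ x₂ ++ u ++ gaussArc q x₃ x₄ ++ v ++ gaussArc r x₅ x₆ ++ w) =
      scaledOddWrithe
        (gaussArc (-p) x₁ x₂ ++ u ++ gaussArc (-q) x₃ x₄ ++ v ++ gaussArc (-r) x₅ x₆ ++ w) := by
  have key (l : ℕ) :
      altCount l (gaussArc p x₁ x₂ ++ u ++ gaussArc q x₃ x₄ ++ v ++ gaussArc r x₅ x₆ ++ w) ^ 2 =
      altCount l (gaussArc (-p) x₁ x₂ ++ u ++ gaussArc (-q) x₃ x₄ ++ v ++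
        gaussArc (-r) x₅ x₆ ++ w) ^ 2 := by
    simp only [altCount_append, altCount_gaussArc, List.length_append, length_gaussArc]
    -- A chord off the three arcs does not see the swap. A chord lying wholly on them has both ends
    -- moved by one position, which negates its count.
    rcases h l with h | h
    · simp only [List.mem_cons, List.not_mem_nil, or_false, forall_eq_or_imp, forall_eq] at h
      obtain ⟨h1, h2, h3, h4, h5, h6⟩ := h
      simp [h1, h2, h3, h4, h5, h6]
    · rw [altCount_eq_zero (w := u) fun y hy => h y (by simp [hy]),
        altCount_eq_zero (w := v) fun y hy => h y (by simp [hy]),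
        altCount_eq_zero (w := w) fun y hy => h y (by simp [hy])]
      simp only [Units.val_neg]
      ring
  simp only [scaledOddWrithe, key]
  simp only [List.map_append, List.sum_append, sum_map_gaussArc]

theorem GaussDiagram.swap_arcs_condition (D : GaussDiagram) {p q r : ℤˣ}
    {x₁ x₂ x₃ x₄ x₅ x₆ : GaussEnd} {u v w : List GaussEnd}
    (hD : D.word = gaussArc p x₁ x₂ ++ u ++ gaussArc q x₃ x₄ ++ v ++ gaussArc r x₅ x₆ ++ w)
    (hA : ∀ x ∈ [x₁, x₂, x₃, x₄, x₅, x₆],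
      (⟨x.label, !x.isOver, x.sign⟩ : GaussEnd) ∈ [x₁, x₂, x₃, x₄, x₅, x₆]) (l : ℕ) :
    (∀ x ∈ [x₁, x₂, x₃, x₄, x₅, x₆], x.label ≠ l) ∨ ∀ y ∈ u ++ v ++ w, y.label ≠ l := by
  have hperm (o : ℤˣ) (x y : GaussEnd) : (gaussArc o x y).Perm [x, y] := by
    unfold gaussArc
    split_ifs
    · exact List.Perm.refl _
    · exact List.Perm.swap _ _ _
  by_contra! hcon
  obtain ⟨⟨x, hx, rfl⟩, y, hy, hxy⟩ := hcon
  refine D.label_ne_of_perm (B := u ++ v ++ w) ?_ hA x hx y hy hxy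
  classical
  rw [hD, List.perm_iff_count]
  intro a
  have h1 := (hperm p x₁ x₂).count_eq a
  have h2 := (hperm q x₃ x₄).count_eq a
  have h3 := (hperm r x₅ x₆).count_eq a
  simp only [List.count_append, h1, h2, h3, List.count_cons, List.count_nil]
  ring

theorem scaledOddWrithe_eq_of_gaussMove {w w' : List GaussEnd} (h : GaussMove w w')
    (D : GaussDiagram) (hD : D.word = w) : scaledOddWrithe w = scaledOddWrithe w' := by
  cases h with
  | rotate u v => exact scaledOddWrithe_rotate D hD
  | relabel f => exact scaledOddWrithe_relabel f w
  | r1 c b s => exact scaledOddWrithe_r1 D hD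
  | r2 c d s o u v => exact scaledOddWrithe_r2 D hD
  | r3 x y z a b c p q r _ _ u v w =>
    exact scaledOddWrithe_swap_arcs (D.swap_arcs_condition hD (by simp))
  | r3' x y z a b c p q r _ _ u v w =>
    exact scaledOddWrithe_swap_arcs (D.swap_arcs_condition hD (by simp))

theorem GaussDiagram.Equivalent.scaledOddWrithe_eq {D E : GaussDiagram} (h : D.Equivalent E) :
    scaledOddWrithe D.word = scaledOddWrithe E.word := by
  induction h with
  | rel D E h => exact scaledOddWrithe_eq_of_gaussMove h D rfl
  | refl => rfl
  | symm _ _ _ ih => exact ih.symm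
  | trans _ _ _ _ _ ih₁ ih₂ => exact ih₁.trans ih₂

/-! ## The chords of a planar Gauss diagram -/

theorem const_of_finRotate {N : ℕ} {X : Type*} {k : Fin N → X}
    (h : ∀ e, k (finRotate N e) = k e) (i j : Fin N) : k i = k j := by
  cases N with
  | zero => exact i.elim0
  | succ m =>
    have key : ∀ i : Fin (m + 1), k i = k 0 := by
      intro i
      induction i using Fin.induction with
      | zero => rfl
      | succ i ih =>
        rw [← ih, ← h i.castSucc, finRotate_apply, Fin.coeSucc_eq_succ]
    rw [key i, key j]

theorem finRotate_val {N : ℕ} (e : Fin N) :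
    (finRotate N e : ℕ) = if (e : ℕ) + 1 = N then 0 else (e : ℕ) + 1 := by
  cases N with
  | zero => exact e.elim0
  | succ m =>
    rw [coe_finRotate]
    simp only [Nat.add_right_cancel_iff, Fin.ext_iff, Fin.val_last]

namespace GaussDiagram

theorem exists_partner (D : GaussDiagram) (i : Fin D.word.length) :
    ∃ j, j ≠ i ∧ (D.word.get j).label = (D.word.get i).label := by
  obtain ⟨j, hj⟩ := List.mem_iff_get.1 (D.partner_mem _ (List.get_mem D.word i))
  refine ⟨j, ?_, by rw [hj]⟩
  rintro rfl
  have := congrArg GaussEnd.isOver hj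
  simp at this

/-- The position of the other endpoint of the chord with an endpoint at `i`. -/
noncomputable def partner (D : GaussDiagram) (i : Fin D.word.length) : Fin D.word.length :=
  (D.exists_partner i).choose

theorem partner_ne (D : GaussDiagram) (i : Fin D.word.length) : D.partner i ≠ i :=
  (D.exists_partner i).choose_spec.1

theorem label_partner (D : GaussDiagram) (i : Fin D.word.length) :
    (D.word.get (D.partner i)).label = (D.word.get i).label :=
  (D.exists_partner i).choose_spec.2

theorem get_eq_of_ne (D : GaussDiagram) {i j : Fin D.word.length} (hne : j ≠ i)
    (h : (D.word.get j).label = (D.word.get i).label) :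
    D.word.get j =
      ⟨(D.word.get i).label, !(D.word.get i).isOver, (D.word.get i).sign⟩ :=
  (D.eq_or_eq_of_label_eq (List.get_mem _ i) (List.get_mem _ j) h).resolve_left
    fun h => hne (D.nodup.injective_get h)

theorem eq_partner (D : GaussDiagram) {i j : Fin D.word.length} (hne : j ≠ i)
    (h : (D.word.get j).label = (D.word.get i).label) : j = D.partner i :=
  D.nodup.injective_get <| by
    rw [D.get_eq_of_ne hne h, D.get_eq_of_ne (D.partner_ne i) (D.label_partner i)]

@[simp]
theorem partner_partner (D : GaussDiagram) (i : Fin D.word.length) :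
    D.partner (D.partner i) = i :=
  (D.eq_partner (D.partner_ne i).symm (D.label_partner i).symm).symm

/-- The involution exchanging the endpoints of each chord. -/
@[simps]
noncomputable def partnerEquiv (D : GaussDiagram) : Equiv.Perm (Fin D.word.length) where
  toFun := D.partner
  invFun := D.partner
  left_inv := D.partner_partner
  right_inv := D.partner_partner

theorem isAlpha_partner (D : GaussDiagram) (i : Fin D.word.length) :
    D.IsAlpha (D.partner i) ↔ ¬ D.IsAlpha i := by
  unfold IsAlpha
  rw [D.get_eq_of_ne (D.partner_ne i) (D.label_partner i)]
  cases (D.word.get i).isOver <;> simp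

theorem altCount_label_get (D : GaussDiagram) {i j : Fin D.word.length} (hne : j ≠ i)
    (h : (D.word.get j).label = (D.word.get i).label) :
    altCount (D.word.get i).label D.word = (-1) ^ (i : ℕ) + (-1) ^ (j : ℕ) := by
  rw [altCount_eq_sum, ← Finset.sum_filter]
  have : (Finset.univ.filter fun k => (D.word.get k).label = (D.word.get i).label) = {i, j} := by
    ext k
    simp only [Finset.mem_filter, Finset.mem_univ, true_and, Finset.mem_insert,
      Finset.mem_singleton]
    constructor
    · intro hk
      by_cases hki : k = i
      · exact Or.inl hki
      · exact Or.inr ((D.eq_partner hki hk).trans (D.eq_partner hne h).symm)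
    · rintro (rfl | rfl)
      · rfl
      · exact h
  rw [this, Finset.sum_pair hne.symm]

open Classical in
theorem two_mul_card_isAlpha (D : GaussDiagram) :
    2 * Fintype.card {i // D.IsAlpha i} = D.word.length := by
  have h1 : Fintype.card {i // D.IsAlpha i} = Fintype.card {i // ¬ D.IsAlpha i} :=
    Fintype.card_congr (D.partnerEquiv.subtypeEquiv fun i => by simp [D.isAlpha_partner])
  have h2 := Fintype.card_subtype_compl D.IsAlpha
  have h3 := Fintype.card_subtype_le D.IsAlpha
  rw [Fintype.card_fin] at h2 h3
  omega

/-! ### Face colourings and Gauss's parity condition -/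

instance (D : GaussDiagram) : Finite (Quot D.FaceStep) := Quot.finite _

/-- The relations between the colours of the darts around the crossing whose strand `α` runs
from the arc `a` to the arc `rot a`. -/
theorem face_relations (D : GaussDiagram) {a b : Fin D.word.length}
    (ha : D.IsAlpha (finRotate _ a)) (hb : finRotate _ b = D.partner (finRotate _ a))
    {X : Type*} (f : Quot D.FaceStep → X) :
    f (Quot.mk _ (a, true)) = f (Quot.mk _ (finRotate _ b, true)) ∧
    f (Quot.mk _ (finRotate _ a, false)) = f (Quot.mk _ (b, false)) ∧
    f (Quot.mk _ (b, true)) = f (Quot.mk _ (a, false)) ∧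
    f (Quot.mk _ (finRotate _ b, false)) = f (Quot.mk _ (finRotate _ a, true)) := by
  have hb' : ¬ D.IsAlpha (finRotate _ b) := by rw [hb, isAlpha_partner]; simpa using ha
  have hne : finRotate _ b ≠ finRotate _ a := hb ▸ D.partner_ne _
  have hl : (D.word.get (finRotate _ b)).label = (D.word.get (finRotate _ a)).label :=
    hb ▸ D.label_partner _
  refine ⟨congrArg f (Quot.sound ⟨?_, ?_, ?_⟩), congrArg f (Quot.sound ⟨?_, ?_, ?_⟩),
    congrArg f (Quot.sound ⟨?_, ?_, ?_⟩), congrArg f (Quot.sound ⟨?_, ?_, ?_⟩)⟩ <;>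
  simp only [dartSource, dartTarget, if_true, if_false, Bool.false_eq_true] <;>
  first
  | exact hne
  | exact hne.symm
  | exact hl
  | exact hl.symm
  | simpa [-finRotate_apply] using ha
  | simpa [-finRotate_apply] using hb'

/-- The sum of the colours of the two faces at an arc. -/
noncomputable def arcSum (D : GaussDiagram) :
    (Quot D.FaceStep → ZMod 2) →ₗ[ZMod 2] (Fin D.word.length → ZMod 2) where
  toFun f e := f (Quot.mk _ (e, true)) + f (Quot.mk _ (e, false))
  map_add' f g := by ext e; simp only [Pi.add_apply]; ring
  map_smul' c f := by ext e; simp only [Pi.smul_apply, smul_eq_mul, RingHom.id_apply]; ring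

/-- The jump of a function on the arcs at an endpoint of a chord. -/
def jump {N : ℕ} : (Fin N → ZMod 2) →ₗ[ZMod 2] (Fin N → ZMod 2) where
  toFun h p := h p + h ((finRotate N).symm p)
  map_add' f g := by ext e; simp only [Pi.add_apply]; ring
  map_smul' c f := by ext e; simp only [Pi.smul_apply, smul_eq_mul, RingHom.id_apply]; ring

/-- Along either strand, the jump is the sum of the colours of the four corners at the crossing. -/
theorem jump_arcSum_partner (D : GaussDiagram) (f : Quot D.FaceStep → ZMod 2)
    (p : Fin D.word.length) :
    jump (D.arcSum f) (D.partner p) = jump (D.arcSum f) p := by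
  wlog hp : D.IsAlpha p generalizing p
  · have := this (D.partner p) ((D.isAlpha_partner p).2 hp)
    rw [partner_partner] at this
    exact this.symm
  obtain ⟨a, rfl⟩ := (finRotate _).surjective p
  obtain ⟨b, hb⟩ := (finRotate _).surjective (D.partner (finRotate _ a))
  obtain ⟨h1, h2, h3, h4⟩ := D.face_relations hp hb f
  rw [← hb]
  simp only [jump, arcSum, LinearMap.coe_mk, AddHom.coe_mk, Equiv.symm_apply_apply, h1, h2, h3, h4]
  ring

theorem eq_of_jump_eq {N : ℕ} {g h : Fin N → ZMod 2} (hj : jump g = jump h) (i : Fin N)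
    (hi : g i = h i) : g = h := by
  have hz : ∀ e, (g - h) (finRotate N e) = (g - h) e := by
    intro e
    have := congrFun hj (finRotate N e)
    simp only [jump, LinearMap.coe_mk, AddHom.coe_mk, Equiv.symm_apply_apply] at this
    simp only [Pi.sub_apply, CharTwo.sub_eq_add]
    have h2 : ∀ a b c d : ZMod 2, a + b = c + d → a + c = b + d := by decide
    exact h2 _ _ _ _ this
  funext j
  have := const_of_finRotate hz j i
  simp only [Pi.sub_apply, hi, sub_self] at this
  exact sub_eq_zero.1 this

/-- If both sides of every arc have the same colour, passing through a crossing does not change it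
either, and the core circle is a single cycle through all arcs. -/
theorem face_const_of_arcSum_eq_zero (D : GaussDiagram) {f : Quot D.FaceStep → ZMod 2}
    (hf : D.arcSum f = 0) (x y : Quot D.FaceStep) : f x = f y := by
  have h2 (e) : f (Quot.mk _ (e, false)) = f (Quot.mk _ (e, true)) := by
    have := congrFun hf e
    simp only [arcSum, LinearMap.coe_mk, AddHom.coe_mk, Pi.zero_apply] at this
    exact (CharTwo.add_eq_zero.1 this).symm
  have hrot (e) : f (Quot.mk _ (finRotate _ e, true)) = f (Quot.mk _ (e, true)) := by
    by_cases hp : D.IsAlpha (finRotate _ e)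
    · obtain ⟨b, hb⟩ := (finRotate _).surjective (D.partner (finRotate _ e))
      obtain ⟨r1, r2, r3, r4⟩ := D.face_relations hp hb f
      rw [← r4, h2, r1]
    · obtain ⟨a, ha⟩ := (finRotate _).surjective (D.partner (finRotate _ e))
      obtain ⟨r1, r2, r3, r4⟩ := D.face_relations (a := a) (b := e)
        (by rw [ha, isAlpha_partner]; exact hp) (by rw [ha, partner_partner]) f
      rw [← r1, r3, h2]
  have hc := const_of_finRotate (k := fun e => f (Quot.mk _ (e, true))) hrot
  induction x using Quot.ind with | mk x => ?_
  induction y using Quot.ind with | mk y => ?_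
  obtain ⟨i, b⟩ := x
  obtain ⟨j, c⟩ := y
  cases b <;> cases c <;> (try simp only [h2]) <;> exact hc i j

/-- On a sphere, every function on the arcs with prescribed equal jumps at the two endpoints of
each chord comes from a colouring of the faces. -/
theorem exists_arcSum_eq (D : GaussDiagram) (hD : 2 * D.numFaces = D.word.length + 4)
    (h : Fin D.word.length → ZMod 2) (hj : ∀ p, jump h (D.partner p) = jump h p)
    (i : Fin D.word.length) : ∃ f, D.arcSum f = h := by
  classical
  have : Fintype (Quot D.FaceStep) := Fintype.ofFinite _
  -- With `n` crossings the target has dimension `n + 1`: the value on one arc and one jump per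
  -- crossing. The Euler characteristic gives a source of dimension `n + 2`, and the kernel consists
  -- of constants, so `Φ` is onto.
  let Φ : (Quot D.FaceStep → ZMod 2) →ₗ[ZMod 2]
      ZMod 2 × ({p // D.IsAlpha p} → ZMod 2) :=
    ((LinearMap.proj i).prod (LinearMap.funLeft (ZMod 2) (ZMod 2) Subtype.val ∘ₗ jump)) ∘ₗ D.arcSum
  have hinj {g g' : Fin D.word.length → ZMod 2} (hg : ∀ p, jump g (D.partner p) = jump g p)
      (hg' : ∀ p, jump g' (D.partner p) = jump g' p) (h0 : g i = g' i)
      (hα : ∀ p, D.IsAlpha p → jump g p = jump g' p) : g = g' := by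
    refine eq_of_jump_eq (funext fun p => ?_) i h0
    by_cases hp : D.IsAlpha p
    · exact hα p hp
    · rw [← hg, ← hg', hα _ ((D.isAlpha_partner p).2 hp)]
  have hker : LinearMap.ker Φ ≤ Submodule.span (ZMod 2) {fun _ => 1} := by
    intro f hf
    have h0 : D.arcSum f i = 0 := congrArg Prod.fst hf
    have hα (p) (hp : D.IsAlpha p) : jump (D.arcSum f) p = 0 :=
      congrFun (congrArg Prod.snd hf) ⟨p, hp⟩
    have hz : D.arcSum f = 0 := hinj (D.jump_arcSum_partner f) (by simp) h0 (by simpa using hα)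
    refine Submodule.mem_span_singleton.2 ⟨f (Quot.mk _ (i, true)), funext fun x => ?_⟩
    simpa using D.face_const_of_arcSum_eq_zero hz _ _
  have hker' : Module.finrank (ZMod 2) (LinearMap.ker Φ) ≤ 1 :=
    (Submodule.finrank_mono hker).trans ((finrank_span_le_card _).trans (by simp))
  have hsurj : Function.Surjective Φ := by
    rw [← LinearMap.range_eq_top]
    apply Submodule.eq_top_of_finrank_eq
    refine le_antisymm (Submodule.finrank_le _) ?_
    have h1 := LinearMap.finrank_range_add_finrank_ker Φ
    have h2 := D.two_mul_card_isAlpha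
    rw [numFaces, Nat.card_eq_fintype_card] at hD
    rw [Module.finrank_fintype_fun_eq_card] at h1
    rw [Module.finrank_prod, Module.finrank_self, Module.finrank_fintype_fun_eq_card]
    omega
  obtain ⟨f, hf⟩ := hsurj (h i, fun p => jump h p)
  exact ⟨f, hinj (D.jump_arcSum_partner f) hj (congrArg Prod.fst hf)
    fun p hp => congrFun (congrArg Prod.snd hf) ⟨p, hp⟩⟩

/-- The sum of the jumps, along the whole core circle, of the colour of the face on the left. -/
theorem sum_arcSum (D : GaussDiagram) (f : Quot D.FaceStep → ZMod 2) :
    ∑ p, D.arcSum f p =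
      ∑ p, open Classical in if D.IsAlpha p then jump (D.arcSum f) p else 0 := by
  classical
  -- The left-hand face changes at `p` across an arc of the other strand. That arc leaves the
  -- crossing if `p` lies on `α` and enters it if `p` lies on `β`; the jump corrects for the second
  -- case. Summed over the circle, the left side telescopes to zero.
  have key (p : Fin D.word.length) :
      f (Quot.mk _ (p, true)) + f (Quot.mk _ ((finRotate _).symm p, true)) =
        D.arcSum f (D.partner p) +
          if D.IsAlpha (D.partner p) then jump (D.arcSum f) (D.partner p) else 0 := by
    obtain ⟨e, rfl⟩ := (finRotate _).surjective p
    obtain ⟨e', he'⟩ := (finRotate _).surjective (D.partner (finRotate _ e))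
    rw [← he', Equiv.symm_apply_apply]
    have h2 : ∀ a b : ZMod 2, a + (a + b) = b := by decide
    have h3 : ∀ a b : ZMod 2, a + b + b = a := by decide
    by_cases hp : D.IsAlpha (finRotate _ e)
    · obtain ⟨r1, r2, r3, r4⟩ := D.face_relations hp he' f
      rw [if_neg (by rw [he', isAlpha_partner]; simpa using hp)]
      simp only [arcSum, LinearMap.coe_mk, AddHom.coe_mk, r1, r4]
      ring
    · have hp' : D.IsAlpha (finRotate _ e') := by rw [he', isAlpha_partner]; exact hp
      obtain ⟨r1, r2, r3, r4⟩ := D.face_relations (a := e') (b := e) hp'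
        (by rw [he', partner_partner]) f
      rw [if_pos hp']
      simp only [jump, LinearMap.coe_mk, AddHom.coe_mk, Equiv.symm_apply_apply, h2]
      simp only [arcSum, LinearMap.coe_mk, AddHom.coe_mk, r1, r3]
  have hpart := Equiv.sum_comp D.partnerEquiv fun p => D.arcSum f p +
    if D.IsAlpha p then jump (D.arcSum f) p else 0
  simp only [partnerEquiv_apply] at hpart
  have hsum := Finset.sum_congr (rfl : Finset.univ = Finset.univ) fun p _ => key p
  rw [Finset.sum_add_distrib, Equiv.sum_comp (finRotate _).symm
    (fun p => f (Quot.mk _ (p, true))), CharTwo.add_self_eq_zero,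
    hpart, Finset.sum_add_distrib] at hsum
  exact CharTwo.add_eq_zero.1 hsum.symm

/-- Gauss's parity condition: the endpoints of a chord of a planar Gauss diagram have positions of
different parity. -/
theorem odd_sub_of_planar (D : GaussDiagram) (hD : 2 * D.numFaces = D.word.length + 4)
    {i j : Fin D.word.length} (hij : i < j)
    (hl : (D.word.get j).label = (D.word.get i).label) : Odd ((j : ℕ) - i) := by
  classical
  have hpi : j = D.partner i := D.eq_partner hij.ne' hl
  have hpj : i = D.partner j := by rw [hpi, partner_partner]
  -- The indicator of one of the two loops into which the chord cuts the circle. The arc `k` starts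
  -- at endpoint `k`, so the loop has `j - i` arcs and jumps only at `i` and `j`.
  let h : Fin D.word.length → ZMod 2 := fun k => if i ≤ k ∧ k < j then 1 else 0
  have hjump (p) : jump h p = if p = i ∨ p = j then 1 else 0 := by
    obtain ⟨e, rfl⟩ := (finRotate _).surjective p
    simp only [h, jump, LinearMap.coe_mk, AddHom.coe_mk, Equiv.symm_apply_apply, Fin.ext_iff,
      Fin.le_def, Fin.lt_def, finRotate_val]
    have := i.2
    have := j.2
    have := e.2
    have := Fin.lt_def.1 hij
    split_ifs <;> first | omega | rfl
  have hmem (p) : (D.partner p = i ∨ D.partner p = j) ↔ (p = i ∨ p = j) := by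
    constructor
    · rintro (h | h)
      · right; rw [hpi, ← h, partner_partner]
      · left; rw [hpj, ← h, partner_partner]
    · rintro (rfl | rfl)
      · exact Or.inr hpi.symm
      · exact Or.inl hpj.symm
  obtain ⟨f, hf⟩ := D.exists_arcSum_eq hD h (fun p => by simp only [hjump, hmem]) i
  have hsum := D.sum_arcSum f
  rw [hf] at hsum
  -- Exactly one of the two endpoints lies on `α`.
  have hR : (∑ p, if D.IsAlpha p then jump h p else 0) = 1 := by
    have hα : D.IsAlpha j ↔ ¬ D.IsAlpha i := hpi ▸ D.isAlpha_partner i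
    have : ∀ p, (if D.IsAlpha p then jump h p else 0) =
        if p = (if D.IsAlpha i then i else j) then 1 else 0 := by
      intro p
      rw [hjump]
      by_cases hi : D.IsAlpha i
      · have hj := hα.not.2 (not_not.2 hi)
        by_cases h1 : p = i
        · simp [h1, hi]
        · by_cases h2 : p = j
          · simp [h2, hj, hi, hij.ne']
          · simp [h1, h2, hi]
      · have hj := hα.2 hi
        by_cases h1 : p = i
        · simp [h1, hi, hij.ne]
        · by_cases h2 : p = j
          · simp [h2, hj, hi]
          · simp [h1, h2, hi]
    simp [this]
  rw [hR] at hsum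
  have hL : ∑ p, h p = (((j : ℕ) - i : ℕ) : ZMod 2) := by
    rw [Finset.sum_boole, ← Fin.card_Ico]
    congr 2
    ext k
    simp
  rw [hL] at hsum
  exact ZMod.natCast_eq_one_iff_odd.1 hsum

theorem IsPlanar.scaledOddWrithe_eq_zero {D : GaussDiagram} (hD : D.IsPlanar) :
    scaledOddWrithe D.word = 0 := by
  rcases hD with hD | hD
  · simp [hD, scaledOddWrithe]
  refine List.sum_eq_zero fun y hy => ?_
  obtain ⟨x, hx, rfl⟩ := List.mem_map.1 hy
  obtain ⟨i, rfl⟩ := List.mem_iff_get.1 hx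
  rw [D.altCount_label_get (D.partner_ne i) (D.label_partner i)]
  have key {a b : ℕ} (hab : a < b) (ho : Odd (b - a)) : (-1 : ℤ) ^ a + (-1) ^ b = 0 := by
    obtain ⟨c, rfl⟩ := Nat.exists_eq_add_of_lt hab
    rw [add_assoc, Nat.add_sub_cancel_left] at ho
    rw [add_assoc, pow_add, ho.neg_one_pow]
    ring
  rcases lt_or_gt_of_ne (D.partner_ne i) with h | h
  · rw [add_comm, key h (D.odd_sub_of_planar hD h (D.label_partner i).symm)]
    simp
  · rw [key h (D.odd_sub_of_planar hD h (D.label_partner i))]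
    simp

theorem IsClassical.scaledOddWrithe_eq_zero {D : GaussDiagram} (hD : D.IsClassical) :
    scaledOddWrithe D.word = 0 := by
  obtain ⟨E, hDE, hE⟩ := hD
  rw [hDE.scaledOddWrithe_eq, hE.scaledOddWrithe_eq_zero]

end GaussDiagram

/-! ## The odd crossings of a virtual pseudodiagram -/

namespace VirtualPseudodiagram

theorem pos_lt (P : VirtualPseudodiagram) (c : Fin P.n) (b : Bool) :
    P.pos c b < P.word.length :=
  List.idxOf_lt_length_of_mem (P.mem_word _)

theorem pos_inj (P : VirtualPseudodiagram) {c d : Fin P.n} {b e : Bool} :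
    P.pos c b = P.pos d e ↔ c = d ∧ b = e := by
  rw [pos, pos, List.idxOf_inj (P.mem_word _), Prod.mk.injEq]

theorem intersect_symm (P : VirtualPseudodiagram) {c d : Fin P.n} (h : P.Intersect c d) :
    P.Intersect d c := by
  by_cases hcd : c = d
  · exact hcd ▸ hcd ▸ h
  have h1 (b e) : P.pos c b ≠ P.pos d e := fun h => hcd (P.pos_inj.1 h).1
  have h2 := h1 true true
  have h3 := h1 true false
  have h4 := h1 false true
  have h5 := h1 false false
  simp only [Intersect, OnArc, Xor] at h ⊢
  omega

theorem not_intersect_self (P : VirtualPseudodiagram) (c : Fin P.n) : ¬ P.Intersect c c := by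
  simp only [Intersect, OnArc, Xor]
  omega

theorem even_card_oddCrossings (P : VirtualPseudodiagram) : Even P.oddCrossings.card := by
  classical
  let G : SimpleGraph (Fin P.n) :=
    { Adj := P.Intersect
      symm := ⟨fun _ _ => P.intersect_symm⟩
      loopless := ⟨P.not_intersect_self⟩ }
  have := G.even_card_odd_degree_vertices
  convert this using 2
  unfold oddCrossings
  congr! 3 with c
  rw [← SimpleGraph.card_neighborFinset_eq_degree]
  congr 1
  ext d
  simp [G]

/-- A chord has exactly one end on the arc between the ends of `c` precisely when it intersects `c`.
So the number of intersections has the parity of the number of positions strictly between them,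
which is their distance minus one. -/
theorem mem_oddCrossings_iff (P : VirtualPseudodiagram) (c : Fin P.n) :
    c ∈ P.oddCrossings ↔ (Even (P.pos c true) ↔ Even (P.pos c false)) := by
  classical
  have hne : P.pos c true ≠ P.pos c false := fun h => by simpa using (P.pos_inj.1 h).2
  have hcard : (Finset.univ.filter fun x : Fin P.n × Bool => P.OnArc c x.1 x.2).card =
      max (P.pos c true) (P.pos c false) - min (P.pos c true) (P.pos c false) - 1 := by
    rw [← Nat.card_Ioo]
    refine Finset.card_bij (fun x _ => P.pos x.1 x.2) ?_ ?_ ?_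
    · intro x hx
      simpa [OnArc] using hx
    · intro x _ y _ h
      exact Prod.ext_iff.2 (P.pos_inj.1 h)
    · intro k hk
      rw [Finset.mem_Ioo] at hk
      have hlt : k < P.word.length := by
        have := P.pos_lt c true
        have := P.pos_lt c false
        omega
      have hpos : P.pos P.word[k].1 P.word[k].2 = k := P.nodup.idxOf_getElem k hlt
      refine ⟨P.word[k], Finset.mem_filter.2 ⟨Finset.mem_univ _, ?_⟩, hpos⟩
      rwa [OnArc, hpos]
  have hpar : ((Finset.univ.filter fun d => P.Intersect c d).card : ZMod 2) =
      ((Finset.univ.filter fun x : Fin P.n × Bool => P.OnArc c x.1 x.2).card : ZMod 2) := by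
    simp only [← Finset.sum_boole, Fintype.sum_prod_type, Fintype.sum_bool]
    refine Finset.sum_congr rfl fun d _ => ?_
    have h11 : (1 : ZMod 2) + 1 = 0 := by decide
    by_cases h1 : P.OnArc c d true <;> by_cases h2 : P.OnArc c d false <;>
      simp [Intersect, Xor, h1, h2, h11]
  rw [oddCrossings, Finset.mem_filter, ← ZMod.natCast_eq_one_iff_odd, hpar,
    ZMod.natCast_eq_one_iff_odd, hcard]
  simp only [Finset.mem_univ, true_and, Nat.odd_iff, Nat.even_iff]
  omega

theorem altCount_diagram (P : VirtualPseudodiagram) (σ : Fin P.n → ℤˣ) (c : Fin P.n) :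
    altCount c (P.diagram σ).word = (-1) ^ P.pos c true + (-1) ^ P.pos c false := by
  have hlen : (P.diagram σ).word.length = P.word.length := List.length_map _
  let i (b : Bool) : Fin (P.diagram σ).word.length := ⟨P.pos c b, hlen ▸ P.pos_lt c b⟩
  have hget (b : Bool) : (P.diagram σ).word.get (i b) = toGaussEnd σ (c, b) := by
    simp [diagram, i, pos]
  have hl (b : Bool) : ((P.diagram σ).word.get (i b)).label = c := by rw [hget]; rfl
  have hne : i false ≠ i true := fun h => by
    simpa using (P.pos_inj.1 (Fin.ext_iff.1 h)).2
  have := (P.diagram σ).altCount_label_get hne ((hl _).trans (hl _).symm)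
  rwa [hl] at this

theorem altCount_diagram_sq (P : VirtualPseudodiagram) (σ : Fin P.n → ℤˣ) (c : Fin P.n) :
    altCount c (P.diagram σ).word ^ 2 = if c ∈ P.oddCrossings then 4 else 0 := by
  simp only [altCount_diagram, mem_oddCrossings_iff]
  by_cases h1 : Even (P.pos c true) <;> by_cases h2 : Even (P.pos c false) <;>
    simp [h1, h2, Odd.neg_one_pow, Nat.not_even_iff_odd.1]

/-- The factor 8 comes from two endpoints per odd chord, each weighted by `(± 2) ^ 2`. -/
theorem scaledOddWrithe_diagram (P : VirtualPseudodiagram) (σ : Fin P.n → ℤˣ) :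
    scaledOddWrithe (P.diagram σ).word = 8 * ∑ c ∈ P.oddCrossings, (σ c : ℤ) := by
  have h : scaledOddWrithe (P.diagram σ).word =
      (P.word.map fun x => (σ x.1 : ℤ) * altCount x.1 (P.diagram σ).word ^ 2).sum := by
    rw [scaledOddWrithe, show (P.diagram σ).word = P.word.map (toGaussEnd σ) from rfl,
      List.map_map]
    rfl
  rw [h, ← List.sum_toFinset _ P.nodup,
    Finset.eq_univ_of_forall fun x => List.mem_toFinset.2 (P.mem_word x)]
  simp only [altCount_diagram_sq, Fintype.sum_prod_type, Fintype.sum_bool]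
  rw [Finset.mul_sum, ← Finset.sum_filter_add_sum_filter_not Finset.univ (· ∈ P.oddCrossings)]
  rw [Finset.sum_eq_zero (s := Finset.univ.filter (· ∉ P.oddCrossings))
    fun c hc => by simp [(Finset.mem_filter.1 hc).2]]
  rw [add_zero, Finset.filter_univ_mem]
  refine Finset.sum_congr rfl fun c hc => ?_
  rw [if_pos hc]
  ring

/-- The odd writhe of a classical knot vanishes. -/
theorem sum_sign_eq_zero (P : VirtualPseudodiagram) {σ : Fin P.n → ℤˣ}
    (h : (P.diagram σ).IsClassical) : ∑ c ∈ P.oddCrossings, (σ c : ℤ) = 0 := by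
  have := h.scaledOddWrithe_eq_zero
  rw [scaledOddWrithe_diagram] at this
  omega

/-! ### Bounds for the virtualizing and classicalizing numbers -/

theorem sum_update (P : VirtualPseudodiagram) (σ : Fin P.n → ℤˣ) {c : Fin P.n}
    (hc : c ∈ P.oddCrossings) (s : ℤˣ) :
    ∑ d ∈ P.oddCrossings, (Function.update σ c s d : ℤ) =
      s + ∑ d ∈ P.oddCrossings.erase c, (σ d : ℤ) := by
  rw [← Finset.add_sum_erase _ _ hc, Function.update_self]
  congr 1
  exact Finset.sum_congr rfl fun d hd => by
    rw [Function.update_of_ne (Finset.ne_of_mem_erase hd)]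

/-- The crossings outside `S` are too few to cancel those in `S`, even if all of them are negative.
-/
theorem resolvePositively_necessarilyNonclassical (P : VirtualPseudodiagram)
    {S : Finset (Fin P.n)} (hS : S ⊆ P.oddCrossings) (hcard : P.oddCrossings.card < 2 * S.card) :
    (P.resolvePositively S).NecessarilyNonclassical := by
  intro σ hσ hcl
  have h0 : ∑ c ∈ P.oddCrossings, (σ c : ℤ) = 0 := P.sum_sign_eq_zero hcl
  have h1 : ∑ c ∈ S, (σ c : ℤ) = S.card := by
    have : ∀ c ∈ S, (σ c : ℤ) = 1 := fun c hc => by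
      rw [hσ c 1 (by simp [resolvePositively, withInfo, hc])]; rfl
    rw [Finset.sum_congr rfl this]
    simp
  have h2 : -((P.oddCrossings \ S).card : ℤ) ≤ ∑ c ∈ P.oddCrossings \ S, (σ c : ℤ) := by
    have := Finset.card_nsmul_le_sum (P.oddCrossings \ S) (fun c => (σ c : ℤ)) (-1) fun c _ => by
      rcases Int.units_eq_one_or (σ c) with h | h <;> simp [h]
    simpa using this
  have h3 := Finset.card_sdiff_add_card_eq_card hS
  rw [← Finset.sum_sdiff hS] at h0
  omega

/-- Resolving all odd precrossings with suitable signs makes the odd writhe non-zero. -/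
theorem exists_nonclassical_of_nonempty (P : VirtualPseudodiagram)
    (h : (P.oddCrossings ∩ P.precrossings).Nonempty) :
    ∃ τ, P.IsPartialResolution τ ∧ (P.withInfo τ).NecessarilyNonclassical ∧
      P.numResolved τ ≤ (P.oddCrossings ∩ P.precrossings).card := by
  obtain ⟨c, hc⟩ := h
  rw [Finset.mem_inter] at hc
  have hcn : P.info c = none := (Finset.mem_filter.1 hc.2).2
  -- The default sign is arbitrary: only the sign at `c` is adjusted, and its two values give sums
  -- differing by 2, which cannot both vanish.
  let σ₀ : Fin P.n → ℤˣ := fun d => (P.info d).getD 1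
  obtain ⟨s, hs⟩ : ∃ s : ℤˣ, ∑ d ∈ P.oddCrossings, (Function.update σ₀ c s d : ℤ) ≠ 0 := by
    by_contra! hcon
    have h1 := hcon 1
    have h2 := hcon (-1)
    rw [P.sum_update _ hc.1] at h1 h2
    simp only [Units.val_one, Units.val_neg] at h1 h2
    omega
  refine ⟨fun d => if d ∈ P.oddCrossings then some (Function.update σ₀ c s d) else P.info d,
    ?_, ?_, ?_⟩
  · intro d t hd
    have hdc : d ≠ c := by rintro rfl; simp [hcn] at hd
    simp [σ₀, hd, hdc]
  · intro σ hσ hcl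
    refine hs ?_
    rw [← P.sum_sign_eq_zero (σ := σ) hcl]
    exact Finset.sum_congr rfl fun d hd => by
      rw [hσ d (Function.update σ₀ c s d) (by simp [withInfo, hd])]
  · refine Finset.card_le_card fun d hd => ?_
    rw [Finset.mem_filter] at hd
    rw [Finset.mem_inter]
    refine ⟨?_, hd.1⟩
    by_contra hodd
    exact hd.2 (by simpa [hodd] using (Finset.mem_filter.1 hd.1).2)

theorem virtualizingNumber_le (P : VirtualPseudodiagram) {τ : Fin P.n → Option ℤˣ}
    (h : P.IsPartialResolution τ) (hτ : (P.withInfo τ).NecessarilyNonclassical) :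
    P.virtualizingNumber ≤ P.numResolved τ :=
  iInf_le_of_le τ (iInf_le_of_le h (iInf_le _ hτ))

/-- If `c` stayed open, its two resolutions would have odd writhes differing by 2, yet both would
have to be zero. -/
theorem resolved_of_necessarilyClassical (P : VirtualPseudodiagram) {τ : Fin P.n → Option ℤˣ}
    (hτ : (P.withInfo τ).NecessarilyClassical) {c : Fin P.n} (hc : c ∈ P.oddCrossings) :
    τ c ≠ none := by
  intro hn
  let σ₀ : Fin P.n → ℤˣ := fun d => (τ d).getD 1
  have key (s : ℤˣ) : (s : ℤ) + ∑ d ∈ P.oddCrossings.erase c, (σ₀ d : ℤ) = 0 := by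
    rw [← P.sum_update σ₀ hc]
    refine P.sum_sign_eq_zero (hτ (Function.update σ₀ c s) fun d t (hd : τ d = some t) => ?_)
    have hdc : d ≠ c := by rintro rfl; simp [hn] at hd
    exact (Function.update_of_ne hdc _ _).trans (by simp [σ₀, hd])
  have h1 := key 1
  have h2 := key (-1)
  simp only [Units.val_one, Units.val_neg] at h1 h2
  omega

end VirtualPseudodiagram

theorem mainTheorem11 (P : VirtualPseudodiagram) :
    Even P.oddCrossings.card ∧
    ((P.oddCrossings ∩ P.precrossings).Nonempty →
      P.virtualizingNumber ≤ ((P.oddCrossings.card / 2 + 1 : ℕ) : ℕ∞)) ∧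
    (∀ S : Finset (Fin P.n), S ⊆ P.oddCrossings ∩ P.precrossings →
      S.card = P.oddCrossings.card / 2 + 1 → (P.resolvePositively S).NecessarilyNonclassical) ∧
    (((P.oddCrossings ∩ P.precrossings).card : ℕ) : ℕ∞) ≤ P.classicalizingNumber := by
  have h3 : ∀ S : Finset (Fin P.n), S ⊆ P.oddCrossings ∩ P.precrossings →
      S.card = P.oddCrossings.card / 2 + 1 →
      (P.resolvePositively S).NecessarilyNonclassical := fun S hS hcard =>
    P.resolvePositively_necessarilyNonclassical (hS.trans Finset.inter_subset_left) (by omega)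
  refine ⟨P.even_card_oddCrossings, fun hne => ?_, h3, ?_⟩
  -- With few odd precrossings, resolve all of them with suitable signs; otherwise there are enough
  -- to make a positive majority among the odd crossings.
  · rcases le_or_gt (P.oddCrossings ∩ P.precrossings).card (P.oddCrossings.card / 2 + 1)
      with hle | hlt
    · obtain ⟨τ, hτ, hn, hcard⟩ := P.exists_nonclassical_of_nonempty hne
      exact (P.virtualizingNumber_le hτ hn).trans (Nat.cast_le.2 (hcard.trans hle))
    · obtain ⟨S, hS, hcard⟩ := Finset.exists_subset_card_eq hlt.le
      have hpre : ∀ c ∈ S, P.info c = none := fun c hc =>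
        (Finset.mem_filter.1 (Finset.mem_inter.1 (hS hc)).2).2
      refine (P.virtualizingNumber_le (τ := fun c => if c ∈ S then some 1 else P.info c)
        (fun c s hc => ?_) (h3 S hS hcard)).trans (Nat.cast_le.2 ?_)
      · have : c ∉ S := fun hcS => by simp [hpre c hcS] at hc
        simp [this, hc]
      · rw [← hcard]
        refine Finset.card_le_card fun c hc => ?_
        rw [Finset.mem_filter] at hc
        by_contra hcS
        exact hc.2 (by simpa [hcS] using (Finset.mem_filter.1 hc.1).2)
  · refine le_iInf fun τ => le_iInf fun _ => le_iInf fun hcl => Nat.cast_le.2 ?_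
    refine Finset.card_le_card fun c hc => ?_
    rw [Finset.mem_inter] at hc
    exact Finset.mem_filter.2 ⟨hc.2, P.resolved_of_necessarilyClassical hcl hc.1⟩
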